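/- For a number field $K$ let $\Sigma_K$ be the set of its finite primes, $\mathcal N\mathfrak p$ the absolute norm of $\mathfrak p\in\Sigma_K$, and $\mathrm{Li}(x)=\int_2^x\frac{dt}{\log t}$. For a finite Galois extension $L/K$ and a prime $\mathfrak p\in\Sigma_K$ unramified in $L$, let $\sigma_{\mathfrak p}\subset\mathrm{Gal}(L/K)$ be the conjugacy class of Frobenius elements of the primes of $L$ dividing $\mathfrak p$. Assume that Chebotarëv's density theorem holds for all cyclic extensions of number fields, over every base field, in the following form: for every Galois extension $M/E$ of number fields with cyclic Galois group $H$, every finite set $S\subset\Sigma_E$ such that $M/E$ is unramified at all primes of $\Sigma_E\setminus S$, every class function $\varphi:H\to\mathbb R$, and the function $\psi:\Sigma_E\setminus S\to\mathbb R$, $\psi(\mathfrak p)=\varphi(\sigma_{\mathfrak p})$, the limit $$\mathbb E_E[\psi]:=\lim_{x\to\infty}\frac{1}{\mathrm{Li}(x)}\sum_{\mathfrak p\in\Sigma_E\setminus S,\ \mathcal N\mathfrak p\le x}\psi(\mathfrak p)$$ exists and $\mathbb E_E[\psi]=|H|^{-1}\sum_{h\in H}\varphi(h)$. Then Chebotarëv's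 density theorem holds for all finite Galois extensions of number fields: for every Galois extension $L/K$ of number fields with group $G=\mathrm{Gal}(L/K)$ and every conjugacy class $C\subset G$, the limit $$d(\Gamma_C^K):=\lim_{x\to\infty}\frac{|\{\mathfrak p\in\Sigma_K:\ \mathfrak p\text{ unramified in }L,\ \sigma_{\mathfrak p}=C,\ \mathcal N\mathfrak p\le x\}|}{\mathrm{Li}(x)}$$ exists and equals $|C|/|G|$. -/

import Mathlib

open NumberField IsDedekindDomain Filter Topology

universe u v

namespace PrimeCounting

/-- `Σ_K`: the set of finite primes (nonzero prime ideals of the ring of integers) of `K`. -/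
abbrev FinitePrime (K : Type*) [Field K] := HeightOneSpectrum (𝓞 K)

/-- The absolute norm `N𝔭 = |𝓞_K / 𝔭|`. -/
noncomputable def primeNorm {K : Type*} [Field K] [NumberField K] (p : FinitePrime K) : ℕ :=
  Ideal.absNorm p.asIdeal

/-- There are only finitely many finite primes of norm at most `x`. -/
theorem finite_primeNorm_le (K : Type*) [Field K] [NumberField K] (x : ℝ) :
    {p : FinitePrime K | (primeNorm p : ℝ) ≤ x}.Finite := by
  refine Set.Finite.of_finite_image (f := fun p : FinitePrime K => p.asIdeal)
    ((Ideal.finite_setOfPred_absNorm_le ⌊x⌋₊).subset ?_) ?_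
  · rintro _ ⟨p, hp, rfl⟩
    exact Nat.le_floor hp
  · intro p _ q _ h
    exact HeightOneSpectrum.ext h

/-- The finite set of primes outside `S` of norm at most `x`. -/
noncomputable def primesUpTo {K : Type*} [Field K] [NumberField K]
    (S : Finset (FinitePrime K)) (x : ℝ) : Finset {p : FinitePrime K // p ∉ S} :=
  ((finite_primeNorm_le K x).preimage
    (Subtype.val_injective (p := fun p : FinitePrime K => p ∉ S)).injOn).toFinset

theorem mem_primesUpTo {K : Type*} [Field K] [NumberField K]
    (S : Finset (FinitePrime K)) (x : ℝ) (p : {p : FinitePrime K // p ∉ S}) :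
    p ∈ primesUpTo S x ↔ (primeNorm p.1 : ℝ) ≤ x := by
  simp [primesUpTo]

/-- `Li(x) = ∫₂ˣ dt / log t`. -/
noncomputable def Li (x : ℝ) : ℝ := ∫ t in (2 : ℝ)..x, (Real.log t)⁻¹

/-- The assertion `𝔼_K[ψ] = a`: the limit of `(∑_{N𝔭 ≤ x} ψ(𝔭)) / Li(x)` as `x → ∞` exists
and equals `a`, the sum being over the primes `𝔭 ∈ Σ_K \ S`. -/
def HasMean {K : Type*} [Field K] [NumberField K] (S : Finset (FinitePrime K))
    (ψ : {p : FinitePrime K // p ∉ S} → ℝ) (a : ℝ) : Prop :=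
  Tendsto (fun x : ℝ => (∑ p ∈ primesUpTo S x, ψ p) / Li x) atTop (𝓝 a)

/-- `𝔭` is unramified in `L`. -/
def Unramified {K : Type*} [Field K] (L : Type*) [Field L] [Algebra K L]
    (p : FinitePrime K) : Prop :=
  Algebra.IsUnramifiedIn (𝓞 L) p.asIdeal

/-- `σ_𝔭`: the set of all Frobenius elements in `Gal(L/K)` of primes of `L` dividing `𝔭`.
If `𝔭` is unramified in `L`, it is a conjugacy class. -/
def frobenius {K : Type*} [Field K] [NumberField K] (L : Type*) [Field L]
    [NumberField L] [Algebra K L] [IsGalois K L]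
    (p : FinitePrime K) : Set Gal(L/K) :=
  {σ | ∃ P ∈ p.asIdeal.primesOver (𝓞 L), IsArithFrobAt (𝓞 K) σ P}

/-- `ψ : Σ_K \ S → Ω` is a frobenian function with associated Galois extension `L/K`, unramified
outside the finite set `S`, and associated class function `φ : Gal(L/K) → Ω`. -/
structure IsFrobenian {K : Type*} [Field K] [NumberField K] (L : Type*) [Field L]
    [NumberField L] [Algebra K L] [IsGalois K L] {Ω : Type*}
    (S : Finset (FinitePrime K)) (ψ : {p : FinitePrime K // p ∉ S} → Ω)
    (φ : Gal(L/K) → Ω) : Prop where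
  unramified : ∀ p : FinitePrime K, p ∉ S → Unramified L p
  classFunction : ∀ g h : Gal(L/K), IsConj g h → φ g = φ h
  eq_apply : ∀ p : {p : FinitePrime K // p ∉ S}, ∀ σ ∈ frobenius L p.1, ψ p = φ σ

/-- `Γ_C^K(x)`: the number of finite primes `𝔭` of `K`, unramified in `L`, such that `σ_𝔭 = C` and
`N𝔭 ≤ x`. -/
noncomputable def primeCount {K : Type*} [Field K] [NumberField K] {L : Type*} [Field L]
    [NumberField L] [Algebra K L] [IsGalois K L] (C : ConjClasses Gal(L/K)) (x : ℝ) : ℕ :=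
  Set.ncard {p : FinitePrime K | Unramified L p ∧ frobenius L p = C.carrier ∧
    (primeNorm p : ℝ) ≤ x}

/-- The assertion `d(Γ_C^K) = a`: the limit of `Γ_C^K(x) / Li(x)` as `x → ∞` exists and
equals `a`. -/
def HasDensity {K : Type*} [Field K] [NumberField K] {L : Type*} [Field L]
    [NumberField L] [Algebra K L] [IsGalois K L] (C : ConjClasses Gal(L/K)) (a : ℝ) : Prop :=
  Tendsto (fun x : ℝ => (primeCount C x : ℝ) / Li x) atTop (𝓝 a)

end PrimeCounting

/-! Choose σ in C, put H = ⟨σ⟩ and let E be the fixed field of H. Then L/E is cyclic, and the known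
case says that the primes q of E with Frobenius σ have density 1/|H|. It remains to compare these q
with the primes of K in Γ_C.

Let q have the same norm as the prime p of K below it. Then σ is a Frobenius element over p as well
(`isArithFrobAt_restrictScalars_iff`). As σ generates Gal(L/E), exactly one prime P of L lies above
q, so such q over p correspond to the P over p with Frobenius σ (`ncard_fibre_eq`). For p unramified
with class C, the centralizer Z of σ permutes these P transitively with stabilizer ⟨σ⟩, so there are
|Z|/|H| of them (`ncard_primesOver_isArithFrobAt`).

The remaining q have norm at least ℓ², with ℓ the rational prime below, so only O(√x) = o(Li(x)) of
them have norm at most x. Hence Γ_C has density (1/|H|)·(|H|/|Z|) = 1/|Z| = |C|/|G|. -/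

namespace PrimeCounting

open scoped Pointwise

/-! ### Frobenius elements and decomposition groups at unramified primes -/

section Local

variable {K L : Type*} [Field K] [Field L] [NumberField L] [Algebra K L]

theorem gal_smul_ringOfIntegers_injective {σ τ : Gal(L/K)}
    (h : ∀ x : 𝓞 L, σ • x = τ • x) : σ = τ := by
  ext y
  obtain ⟨a, b, hb, rfl⟩ := IsFractionRing.div_surjective (A := 𝓞 L) y
  have key (z : 𝓞 L) : σ (algebraMap (𝓞 L) L z) = τ (algebraMap (𝓞 L) L z) :=
    congrArg (algebraMap (𝓞 L) L) (h z)
  rw [map_div₀, map_div₀, key, key]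

theorem finite_quotient_of_mem_primesOver {p : FinitePrime K} {P : Ideal (𝓞 L)}
    (hP : P ∈ p.asIdeal.primesOver (𝓞 L)) : Finite (𝓞 L ⧸ P) :=
  have := hP.1
  have := hP.2
  Ideal.finiteQuotientOfFreeOfNeBot P (Ideal.ne_bot_of_liesOver_of_ne_bot p.ne_bot P)

variable [NumberField K] [IsGalois K L]

theorem isArithFrobAt_unique {P : Ideal (𝓞 L)} [P.IsPrime]
    [Algebra.IsUnramifiedAt (𝓞 K) P] {σ τ : Gal(L/K)}
    (hσ : IsArithFrobAt (𝓞 K) σ P) (hτ : IsArithFrobAt (𝓞 K) τ P) : σ = τ := by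
  have := AlgHom.IsArithFrobAt.eq_of_isUnramifiedAt hσ hτ P.primeCompl_le_nonZeroDivisors
  exact gal_smul_ringOfIntegers_injective fun x => DFunLike.congr_fun this x

/-- An inertia element times a Frobenius element is again a Frobenius element at P, and at an
unramified prime that element is unique. -/
theorem eq_one_of_mem_inertia {P : Ideal (𝓞 L)} [P.IsPrime] [Finite (𝓞 L ⧸ P)]
    [Algebra.IsUnramifiedAt (𝓞 K) P] {τ : Gal(L/K)} (hτ : ∀ x : 𝓞 L, τ • x - x ∈ P) :
    τ = 1 := by
  obtain ⟨σ, hσ⟩ := IsArithFrobAt.exists_of_isInvariant (𝓞 K) Gal(L/K) P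
  have h : IsArithFrobAt (𝓞 K) (τ * σ) P := fun x => by
    have := add_mem (hτ (σ • x)) (hσ x)
    simpa [mul_smul] using this
  simpa using isArithFrobAt_unique h hσ

attribute [local instance] Ideal.Quotient.field in
/-- The decomposition group of an unramified prime is generated by its Frobenius element. -/
theorem stabilizer_eq_zpowers {P : Ideal (𝓞 L)} [P.IsPrime] [Finite (𝓞 L ⧸ P)]
    [Algebra.IsUnramifiedAt (𝓞 K) P] {σ : Gal(L/K)} (hσ : IsArithFrobAt (𝓞 K) σ P) :
    MulAction.stabilizer Gal(L/K) P = Subgroup.zpowers σ := by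
  refine le_antisymm (fun τ hτ => ?_) ((Subgroup.zpowers_le).mpr hσ.mem_stabilizer)
  have : P.IsMaximal :=
    Ideal.Quotient.maximal_of_isField _ (Finite.isField_of_domain (𝓞 L ⧸ P))
  set p := P.under (𝓞 K)
  have : p.IsMaximal := Ideal.IsMaximal.under (𝓞 K) P
  have : Finite (𝓞 K ⧸ p) := .of_injective _ Ideal.algebraMap_quotient_injective
  cases nonempty_fintype (𝓞 K ⧸ p)
  -- Automorphisms of an extension of finite fields are powers of Frobenius, so τ acts on the
  -- residue field as some σⁿ. Then σ⁻ⁿτ lies in the inertia group, which is trivial.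
  obtain ⟨n, hn⟩ := (FiniteField.bijective_frobeniusAlgEquivOfAlgebraic_pow
    (𝓞 K ⧸ p) (𝓞 L ⧸ P)).2 (Ideal.Quotient.stabilizerHom P p Gal(L/K) ⟨τ, hτ⟩)
  have hpow : ∀ (k : ℕ) (x : 𝓞 L), Ideal.Quotient.mk P (σ ^ k • x) =
      Ideal.Quotient.mk P x ^ Nat.card (𝓞 K ⧸ p) ^ k := by
    intro k
    induction k with
    | zero => simp
    | succ k ih =>
      intro x
      rw [pow_succ, mul_smul, ih, pow_succ, mul_comm, pow_mul]
      exact congrArg (· ^ _) (hσ.mk_apply x)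
  have hτ' (x : 𝓞 L) : Ideal.Quotient.mk P (τ • x) = Ideal.Quotient.mk P (σ ^ (n : ℕ) • x) := by
    rw [hpow, Nat.card_eq_fintype_card]
    have h1 := DFunLike.congr_fun hn (Ideal.Quotient.mk P x)
    have h2 := congrFun (FiniteField.coe_frobeniusAlgEquivOfAlgebraic_iterate
      (𝓞 K ⧸ p) (𝓞 L ⧸ P) n) (Ideal.Quotient.mk P x)
    rw [← h2, ← AlgEquiv.coe_pow]
    exact h1.symm
  have hone : (σ ^ (n : ℕ))⁻¹ * τ = 1 := by
    refine eq_one_of_mem_inertia (P := P) fun x => ?_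
    have hs : (σ ^ (n : ℕ))⁻¹ • P = P :=
      inv_mem (pow_mem hσ.mem_stabilizer _)
    refine hs.le ?_
    rw [Ideal.mem_inv_pointwise_smul_iff, smul_sub, mul_smul, smul_inv_smul,
      ← Ideal.Quotient.eq, hτ']
  rw [inv_mul_eq_one] at hone
  exact hone ▸ Subgroup.npow_mem_zpowers σ n

theorem conj_mem_frobenius {p : FinitePrime K} {σ : Gal(L/K)} (hσ : σ ∈ frobenius L p)
    (τ : Gal(L/K)) : τ * σ * τ⁻¹ ∈ frobenius L p := by
  obtain ⟨P, ⟨hP, hPp⟩, h⟩ := hσ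
  exact ⟨τ • P, ⟨inferInstance, inferInstance⟩, h.conj τ⟩

theorem exists_smul_eq_of_mem_primesOver {p : Ideal (𝓞 K)} {P Q : Ideal (𝓞 L)}
    (hP : P ∈ p.primesOver (𝓞 L)) (hQ : Q ∈ p.primesOver (𝓞 L)) :
    ∃ τ : Gal(L/K), Q = τ • P := by
  have := hP.1
  have := hQ.1
  exact Algebra.IsInvariant.exists_smul_of_under_eq (𝓞 K) (𝓞 L) Gal(L/K) _ _
    (hP.2.over.symm.trans hQ.2.over)

theorem isConj_of_mem_frobenius {p : FinitePrime K} (hp : Unramified L p) {σ τ : Gal(L/K)}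
    (hσ : σ ∈ frobenius L p) (hτ : τ ∈ frobenius L p) : IsConj σ τ := by
  obtain ⟨P, hP, h⟩ := hσ
  obtain ⟨Q, hQ, h'⟩ := hτ
  obtain ⟨g, rfl⟩ := exists_smul_eq_of_mem_primesOver hP hQ
  have := hQ.1
  have := hp _ hQ.1 hQ.2
  exact isConj_iff.mpr ⟨g, isArithFrobAt_unique (h.conj g) h'⟩

theorem frobenius_eq_carrier_iff {p : FinitePrime K} (hp : Unramified L p) (σ : Gal(L/K)) :
    frobenius L p = (ConjClasses.mk σ).carrier ↔ σ ∈ frobenius L p := by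
  refine ⟨fun h => h ▸ ConjClasses.mem_carrier_mk, fun h => Set.ext fun τ => ?_⟩
  rw [ConjClasses.mem_carrier_iff_mk_eq, ConjClasses.mk_eq_mk_iff_isConj]
  refine ⟨fun h' => isConj_of_mem_frobenius hp h' h, fun h' => ?_⟩
  obtain ⟨g, rfl⟩ := isConj_iff.mp h'.symm
  exact conj_mem_frobenius h g

/-- The number of primes above an unramified `𝔭` with a given Frobenius element. -/
theorem ncard_primesOver_isArithFrobAt {p : FinitePrime K} (hp : Unramified L p) {σ : Gal(L/K)}
    (hσ : σ ∈ frobenius L p) :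
    {P ∈ p.asIdeal.primesOver (𝓞 L) | IsArithFrobAt (𝓞 K) σ P}.ncard * orderOf σ =
      Nat.card (Subgroup.centralizer {σ}) := by
  obtain ⟨P, hP, h⟩ := hσ
  have := hP.1
  have := hP.2
  have := hp _ hP.1 hP.2
  have := finite_quotient_of_mem_primesOver hP
  set Z := Subgroup.centralizer {σ}
  -- The Frobenius element at gP is gσg⁻¹, which equals σ exactly when g centralizes σ;
  -- orbit-stabilizer then gives the count.
  have horb : MulAction.orbit Z P =
      {P ∈ p.asIdeal.primesOver (𝓞 L) | IsArithFrobAt (𝓞 K) σ P} := by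
    ext Q
    constructor
    · rintro ⟨⟨g, hg⟩, rfl⟩
      have hg' : g * σ * g⁻¹ = σ := by
        rw [mul_inv_eq_iff_eq_mul]
        exact (Subgroup.mem_centralizer_singleton_iff.mp hg)
      refine ⟨⟨inferInstanceAs (g • P).IsPrime, inferInstanceAs ((g • P).LiesOver _)⟩, ?_⟩
      have := h.conj g
      rwa [hg'] at this
    · rintro ⟨hQ, h'⟩
      obtain ⟨g, rfl⟩ := exists_smul_eq_of_mem_primesOver hP hQ
      have := hQ.1
      have := hp _ hQ.1 hQ.2
      refine ⟨⟨g, ?_⟩, rfl⟩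
      have := isArithFrobAt_unique (h.conj g) h'
      rw [mul_inv_eq_iff_eq_mul] at this
      exact Subgroup.mem_centralizer_singleton_iff.mpr this
  have hle : Subgroup.zpowers σ ≤ Z := by
    rw [Subgroup.zpowers_le]
    exact Subgroup.mem_centralizer_singleton_iff.mpr rfl
  have hstab : MulAction.stabilizer Z P = (Subgroup.zpowers σ).subgroupOf Z := by
    rw [← stabilizer_eq_zpowers h]
    rfl
  rw [← horb, ← MulAction.index_stabilizer, hstab, ← Nat.card_zpowers,
    ← Nat.card_congr (Subgroup.subgroupOfEquivOfLe hle).toEquiv, Subgroup.index_mul_card]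

end Local

/-! ### Ramified primes and residue fields -/

theorem primeNorm_eq_natCard {K : Type*} [Field K] [NumberField K] (p : FinitePrime K) :
    primeNorm p = Nat.card (𝓞 K ⧸ p.asIdeal) := by
  rw [primeNorm, Ideal.absNorm_apply, Submodule.cardQuot_apply]

-- A ramified prime of K lies below one of the finitely many prime divisors of the different.
attribute [local instance] FractionRing.liftAlgebra in
theorem finite_not_unramified (K L : Type*) [Field K] [NumberField K] [Field L] [NumberField L]
    [Algebra K L] : {p : FinitePrime K | ¬ Unramified L p}.Finite := by
  refine ((Ideal.finite_factors (differentIdeal_ne_bot (A := 𝓞 K) (B := 𝓞 L))).image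
    (HeightOneSpectrum.under (𝓞 K))).subset fun p hp => ?_
  simp only [Set.mem_ofPred_eq, Unramified, Algebra.IsUnramifiedIn, not_forall] at hp
  obtain ⟨P, hP, hPp, h⟩ := hp
  refine ⟨⟨P, hP, Ideal.ne_bot_of_liesOver_of_ne_bot p.ne_bot P⟩, dvd_differentIdeal_iff.mpr h, ?_⟩
  exact HeightOneSpectrum.ext hPp.over.symm

theorem natCard_quotient_under_le (K : Type*) {E : Type*} [Field K] [Field E] [Algebra K E]
    (q : Ideal (𝓞 E)) [Finite (𝓞 E ⧸ q)] :
    Nat.card (𝓞 K ⧸ q.under (𝓞 K)) ≤ Nat.card (𝓞 E ⧸ q) :=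
  Nat.card_le_card_of_injective _
    (Ideal.algebraMap_quotient_injective (R := 𝓞 K) (I := q))

theorem natCard_le_of_forall_pow_eq {F : Type*} [Field F] {n : ℕ} (hn : 1 < n)
    (h : ∀ x : F, x ^ n = x) : Nat.card F ≤ n := by
  classical
  have hne := FiniteField.X_pow_card_sub_X_ne_zero F hn
  have hroot (x : F) : x ∈ (Polynomial.X ^ n - Polynomial.X : Polynomial F).roots.toFinset := by
    rw [Multiset.mem_toFinset, Polynomial.mem_roots hne]
    simp [h x]
  have : Fintype F := ⟨_, hroot⟩
  rw [Nat.card_eq_fintype_card]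
  calc Fintype.card F ≤ (Polynomial.X ^ n - Polynomial.X : Polynomial F).roots.toFinset.card :=
        Finset.card_le_card fun x _ => hroot x
    _ ≤ _ := Multiset.toFinset_card_le _
    _ ≤ _ := Polynomial.card_roots' _
    _ = n := FiniteField.X_pow_card_sub_X_natDegree_eq F hn

/-! ### Primes and Frobenius elements in a tower L/E/K -/

section Tower

variable (K : Type*) {E L : Type*} [Field K] [Field E] [Field L]
  [Algebra K E] [Algebra K L] [Algebra E L] [IsScalarTower K E L]

theorem Unramified.of_under {q : FinitePrime E} (h : Unramified L (q.under (𝓞 K))) :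
    Unramified L q := fun P hP _ =>
  have : P.LiesOver (q.under (𝓞 K)).asIdeal :=
    have : q.asIdeal.LiesOver (q.under (𝓞 K)).asIdeal := ⟨rfl⟩
    Ideal.LiesOver.trans P q.asIdeal _
  have := h P hP this
  Algebra.IsUnramifiedAt.of_restrictScalars (𝓞 K) P

variable [NumberField K] [NumberField E]

theorem finite_preimage_under {s : Set (FinitePrime K)} (hs : s.Finite) :
    {q : FinitePrime E | q.under (𝓞 K) ∈ s}.Finite := by
  refine hs.preimage' fun p _ => ?_
  refine Set.Finite.of_finite_image (f := fun q : FinitePrime E => q.asIdeal)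
    ((Algebra.QuasiFinite.finite_primesOver (S := 𝓞 E) p.asIdeal).subset ?_) ?_
  · rintro _ ⟨q, rfl, rfl⟩
    exact ⟨q.isPrime, ⟨rfl⟩⟩
  · intro q _ q' _ h
    exact HeightOneSpectrum.ext h

variable [NumberField L] [IsGalois K L] [IsGalois E L]

/-- For `σ ∈ Gal(L/E)`, being a Frobenius element over `K` means being one over `E` and the
residue field of `E` being no larger than that of `K`. -/
theorem isArithFrobAt_restrictScalars_iff (σ : Gal(L/E)) (P : Ideal (𝓞 L)) [P.IsPrime]
    [Finite (𝓞 L ⧸ P)] :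
    IsArithFrobAt (𝓞 K) (σ.restrictScalars K) P ↔ IsArithFrobAt (𝓞 E) σ P ∧
      Nat.card (𝓞 E ⧸ P.under (𝓞 E)) = Nat.card (𝓞 K ⧸ P.under (𝓞 K)) := by
  have hE : Finite (𝓞 E ⧸ P.under (𝓞 E)) :=
    .of_injective _ (Ideal.algebraMap_quotient_injective (R := 𝓞 E) (I := P))
  have hK : Finite (𝓞 K ⧸ P.under (𝓞 K)) :=
    .of_injective _ (Ideal.algebraMap_quotient_injective (R := 𝓞 K) (I := P))
  have : (P.under (𝓞 E)).IsMaximal :=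
    Ideal.Quotient.maximal_of_isField _ (Finite.isField_of_domain _)
  have hunder : (P.under (𝓞 E)).under (𝓞 K) = P.under (𝓞 K) := Ideal.under_under _
  constructor
  · intro h
    have hcard : Nat.card (𝓞 E ⧸ P.under (𝓞 E)) = Nat.card (𝓞 K ⧸ P.under (𝓞 K)) := by
      refine le_antisymm ?_ ?_
      · let _ := Ideal.Quotient.field (P.under (𝓞 E))
        -- Since σ fixes E, raising to the power given by the residue field size of K is the
        -- identity on the residue field of E, which therefore has at most that many elements.
        refine natCard_le_of_forall_pow_eq Finite.one_lt_card fun y => ?_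
        obtain ⟨y, rfl⟩ := Ideal.Quotient.mk_surjective y
        apply Ideal.algebraMap_quotient_injective (R := 𝓞 E) (I := P)
        have hfix : σ.restrictScalars K • algebraMap (𝓞 E) (𝓞 L) y = algebraMap (𝓞 E) (𝓞 L) y :=
          smul_algebraMap σ y
        have := h.mk_apply (algebraMap (𝓞 E) (𝓞 L) y)
        rw [MulSemiringAction.toAlgHom_apply, hfix] at this
        rw [map_pow]
        exact this.symm
      · rw [← hunder]
        exact natCard_quotient_under_le K _
    refine ⟨fun x => ?_, hcard⟩
    rw [hcard]
    exact h x
  · rintro ⟨h, hcard⟩ x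
    rw [← hcard]
    exact h x

/-- The bijection is P ↦ P ∩ E. It is injective because Gal(L/E) permutes the primes above q
transitively, while its generator σ, being Frobenius at P, fixes P. -/
theorem ncard_fibre_eq {σ : Gal(L/E)} (hgen : ∀ τ : Gal(L/E), τ ∈ Subgroup.zpowers σ)
    (p : FinitePrime K) :
    {q : FinitePrime E | q.under (𝓞 K) = p ∧ primeNorm q = primeNorm (q.under (𝓞 K)) ∧
      σ ∈ frobenius L q}.ncard =
    {P ∈ p.asIdeal.primesOver (𝓞 L) | IsArithFrobAt (𝓞 K) (σ.restrictScalars K) P}.ncard := by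
  have hne {P : Ideal (𝓞 L)} (hP : P ∈ p.asIdeal.primesOver (𝓞 L)) : P ≠ ⊥ :=
    have := hP.2
    Ideal.ne_bot_of_liesOver_of_ne_bot p.ne_bot P
  symm
  refine Set.ncard_congr (fun P hP => HeightOneSpectrum.under (𝓞 E) ⟨P, hP.1.1, hne hP.1⟩) ?_ ?_ ?_
  · rintro P ⟨hP, h⟩
    have := hP.1
    have := finite_quotient_of_mem_primesOver hP
    obtain ⟨h1, h2⟩ := (isArithFrobAt_restrictScalars_iff K σ P).mp h
    have hunder : (P.under (𝓞 E)).under (𝓞 K) = P.under (𝓞 K) := Ideal.under_under _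
    refine ⟨HeightOneSpectrum.ext (hunder.trans hP.2.over.symm), ?_, P, ⟨hP.1, ⟨rfl⟩⟩, h1⟩
    rw [primeNorm_eq_natCard, primeNorm_eq_natCard]
    change Nat.card (𝓞 E ⧸ P.under (𝓞 E)) = Nat.card (𝓞 K ⧸ (P.under (𝓞 E)).under (𝓞 K))
    rw [hunder, h2]
  · rintro P Q ⟨hP, h⟩ ⟨hQ, h'⟩ heq
    have := hP.1
    have := hQ.1
    have := finite_quotient_of_mem_primesOver hP
    have heq' : P.under (𝓞 E) = Q.under (𝓞 E) := congrArg HeightOneSpectrum.asIdeal heq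
    obtain ⟨h1, -⟩ := (isArithFrobAt_restrictScalars_iff K σ P).mp h
    obtain ⟨τ, hτ⟩ := Algebra.IsInvariant.exists_smul_of_under_eq (𝓞 E) (𝓞 L) Gal(L/E) P Q heq'
    have hle : Subgroup.zpowers σ ≤ MulAction.stabilizer Gal(L/E) P :=
      Subgroup.zpowers_le.mpr h1.mem_stabilizer
    rw [hτ]
    exact (hle (hgen τ)).symm
  · rintro q ⟨rfl, hcard, P, hP, h⟩
    have := hP.1
    have := hP.2
    have := finite_quotient_of_mem_primesOver hP
    have hover : P.under (𝓞 E) = q.asIdeal := hP.2.over.symm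
    have hunder : (P.under (𝓞 E)).under (𝓞 K) = P.under (𝓞 K) := Ideal.under_under _
    refine ⟨P, ⟨⟨hP.1, ⟨?_⟩⟩, (isArithFrobAt_restrictScalars_iff K σ P).mpr ⟨h, ?_⟩⟩,
      HeightOneSpectrum.ext hover⟩
    · rw [← hunder, hover]
      rfl
    · rw [primeNorm_eq_natCard, primeNorm_eq_natCard] at hcard
      rw [← hunder, hover]
      exact hcard

end Tower

/-! ### Scarcity of primes of E whose norm exceeds that of the prime below -/

/-- The rational prime below a finite prime. -/
noncomputable def residueChar {E : Type*} [Field E] (q : FinitePrime E) : ℕ :=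
  Ideal.absNorm (Ideal.under ℤ q.asIdeal)

theorem residueChar_prime {E : Type*} [Field E] [NumberField E] (q : FinitePrime E) :
    (residueChar q).Prime :=
  have : NeZero q.asIdeal := ⟨q.ne_bot⟩
  Nat.absNorm_under_prime q.asIdeal

theorem exists_primeNorm_eq_pow {E : Type*} [Field E] [NumberField E] (q : FinitePrime E) :
    ∃ k, primeNorm q = residueChar q ^ k :=
  have : q.asIdeal.LiesOver (Ideal.span {(residueChar q : ℤ)}) :=
    Int.liesOver_span_absNorm q.asIdeal
  ⟨_, Ideal.absNorm_eq_pow_inertiaDeg' q.asIdeal (residueChar_prime q)⟩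

theorem one_lt_primeNorm {E : Type*} [Field E] [NumberField E] (q : FinitePrime E) :
    1 < primeNorm q := by
  have := Ideal.finiteQuotientOfFreeOfNeBot q.asIdeal q.ne_bot
  rw [primeNorm_eq_natCard]
  exact Finite.one_lt_card

theorem primeNorm_under_le (K : Type*) {E : Type*} [Field K] [Field E] [NumberField K]
    [NumberField E] [Algebra K E] (q : FinitePrime E) :
    primeNorm (q.under (𝓞 K)) ≤ primeNorm q := by
  have := Ideal.finiteQuotientOfFreeOfNeBot q.asIdeal q.ne_bot
  rw [primeNorm_eq_natCard, primeNorm_eq_natCard]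
  exact natCard_quotient_under_le K q.asIdeal

theorem residueChar_under (K : Type*) {E : Type*} [Field K] [Field E] [NumberField K]
    [NumberField E] [Algebra K E] (q : FinitePrime E) :
    residueChar (q.under (𝓞 K)) = residueChar q := by
  have : (q.asIdeal.under (𝓞 K)).under ℤ = q.asIdeal.under ℤ := Ideal.under_under _
  exact congrArg Ideal.absNorm this

/-- Both norms are powers of the same rational prime with positive exponent, so the strictly larger
one has exponent at least 2. -/
theorem residueChar_sq_le_of_ne (K : Type*) {E : Type*} [Field K] [Field E] [NumberField K]
    [NumberField E] [Algebra K E] {q : FinitePrime E}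
    (h : primeNorm q ≠ primeNorm (q.under (𝓞 K))) : residueChar q ^ 2 ≤ primeNorm q := by
  obtain ⟨k, hk⟩ := exists_primeNorm_eq_pow q
  obtain ⟨l, hl⟩ := exists_primeNorm_eq_pow (q.under (𝓞 K))
  rw [residueChar_under] at hl
  have hlt : primeNorm (q.under (𝓞 K)) < primeNorm q :=
    lt_of_le_of_ne (primeNorm_under_le K q) h.symm
  have hone := one_lt_primeNorm (q.under (𝓞 K))
  have hp := (residueChar_prime q).one_lt
  rw [hk, hl, Nat.pow_lt_pow_iff_right hp] at hlt
  rw [hl] at hone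
  have hl0 : l ≠ 0 := by
    rintro rfl
    simp at hone
  rw [hk]
  exact Nat.pow_le_pow_right (by omega) (by omega)

theorem ncard_primesOver_le_finrank {E : Type*} [Field E] [NumberField E] (p : Ideal ℤ)
    [p.IsPrime] : (p.primesOver (𝓞 E)).ncard ≤ Module.finrank ℤ (𝓞 E) := by
  have : Fintype (p.primesOver (𝓞 E)) := (Algebra.QuasiFinite.finite_primesOver p).fintype
  rw [← Ideal.sum_ramification_inertia_eq_finrank p (𝓞 E), ← Set.fintypeCard_eq_ncard,
    ← Finset.card_univ, Finset.card_eq_sum_ones]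
  refine Finset.sum_le_sum fun P _ => Nat.mul_pos ?_ ?_
  · exact Ideal.ramificationIdx_pos _ _
  · exact Ideal.inertiaDeg_pos _ _

/-- The rational primes involved are at most √x, and each has at most [E : ℚ] primes of E above it.
-/
theorem card_le_of_residueChar_sq_le {E : Type*} [Field E] [NumberField E]
    {T : Finset (FinitePrime E)} {x : ℝ}
    (hT : ∀ q ∈ T, (residueChar q : ℝ) ^ 2 ≤ x) :
    (T.card : ℝ) ≤ Module.finrank ℤ (𝓞 E) * (√x + 1) := by
  classical
  have himg : (T.image residueChar).card ≤ ⌊√x⌋₊ + 1 := by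
    rw [← Finset.card_range (⌊√x⌋₊ + 1)]
    refine Finset.card_le_card fun l hl => ?_
    obtain ⟨q, hq, rfl⟩ := Finset.mem_image.mp hl
    exact Finset.mem_range_succ_iff.mpr (Nat.le_floor (Real.le_sqrt_of_sq_le (hT q hq)))
  have hfib : ∀ l ∈ T.image residueChar,
      (T.filter (residueChar · = l)).card ≤ Module.finrank ℤ (𝓞 E) := by
    intro l hl
    obtain ⟨q, hq, rfl⟩ := Finset.mem_image.mp hl
    have hp := residueChar_prime q
    have : Fact (residueChar q).Prime := ⟨hp⟩
    have : (Ideal.span {(residueChar q : ℤ)}).IsPrime := inferInstance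
    refine le_trans ?_ (ncard_primesOver_le_finrank (Ideal.span {(residueChar q : ℤ)}))
    rw [← Set.ncard_coe_finset]
    refine Set.ncard_le_ncard_of_injOn HeightOneSpectrum.asIdeal ?_ ?_
      (Algebra.QuasiFinite.finite_primesOver _)
    · intro r hr
      have hr' : residueChar r = residueChar q := (Finset.mem_filter.mp hr).2
      rw [← hr']
      exact ⟨r.isPrime, Int.liesOver_span_absNorm r.asIdeal⟩
    · intro r _ s _ h
      exact HeightOneSpectrum.ext h
  have hmul := (Finset.card_le_mul_card_image T _ hfib).trans (Nat.mul_le_mul_left _ himg)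
  calc (T.card : ℝ) ≤ (Module.finrank ℤ (𝓞 E) * (⌊√x⌋₊ + 1) : ℕ) := by exact_mod_cast hmul
    _ ≤ _ := by
      push_cast
      gcongr
      exact Nat.floor_le (Real.sqrt_nonneg x)

/-! ### Growth of the logarithmic integral -/

theorem le_Li {x : ℝ} (hx : 2 ≤ x) : (x - 2) / Real.log x ≤ Li x := by
  have hpos {t : ℝ} (ht : 2 ≤ t) : 0 < Real.log t := Real.log_pos (by linarith)
  have h : ∫ _ in (2 : ℝ)..x, (Real.log x)⁻¹ ≤ Li x := by
    refine intervalIntegral.integral_mono_on hx intervalIntegrable_const ?_ fun t ht => ?_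
    · refine ContinuousOn.intervalIntegrable fun t ht => ?_
      rw [Set.uIcc_of_le hx] at ht
      exact ((Real.continuousAt_log (by linarith [ht.1])).inv₀ (hpos ht.1).ne').continuousWithinAt
    · have := hpos ht.1
      exact inv_anti₀ this (Real.log_le_log (by linarith [ht.1]) ht.2)
  rwa [intervalIntegral.integral_const, smul_eq_mul, ← div_eq_mul_inv] at h

/-- `√x = o(Li(x))`. -/
theorem tendsto_sqrt_add_one_div_Li :
    Tendsto (fun x : ℝ => (√x + 1) / Li x) atTop (𝓝 0) := by
  -- For x ≥ 4, √x + 1 ≤ 2√x and Li(x) ≥ (x - 2)/log x ≥ x/(2 log x); the quotient of these bounds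
  -- is 4 log x/√x.
  have hlog : Tendsto (fun x : ℝ => 4 * (Real.log x / x ^ (1 / 2 : ℝ))) atTop (𝓝 0) := by
    simpa using (isLittleO_log_rpow_atTop (r := 1 / 2) (by norm_num)).tendsto_div_nhds_zero.const_mul 4
  refine squeeze_zero' ?_ ?_ hlog
  · filter_upwards [eventually_ge_atTop 2] with x hx
    have : 0 ≤ Li x := le_trans (div_nonneg (by linarith) (Real.log_nonneg (by linarith))) (le_Li hx)
    positivity
  · filter_upwards [eventually_ge_atTop 4] with x hx
    have hl : 0 < Real.log x := Real.log_pos (by linarith)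
    have hs : 2 ≤ √x := Real.le_sqrt_of_sq_le (by linarith)
    have hsq : √x * √x = x := Real.mul_self_sqrt (by linarith)
    have hLi : x / (2 * Real.log x) ≤ Li x := by
      refine le_trans ?_ (le_Li (by linarith))
      rw [div_le_div_iff₀ (by positivity) hl]
      nlinarith
    rw [← Real.sqrt_eq_rpow]
    calc (√x + 1) / Li x ≤ (2 * √x) / (x / (2 * Real.log x)) := by gcongr; linarith
      _ = 4 * (Real.log x / √x) := by
        nth_rw 2 [← hsq]
        field_simp
        norm_num

/-! ### Transfer of the density from E to K -/

theorem natCard_carrier_mul_natCard_centralizer {G : Type*} [Group G] [Finite G] (g : G) :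
    Nat.card (ConjClasses.mk g).carrier * Nat.card (Subgroup.centralizer {g}) = Nat.card G := by
  rw [Subgroup.nat_card_centralizer_nat_card_stabilizer, ← ConjAct.orbit_eq_carrier_conjClasses,
    ← Nat.card_prod]
  exact Nat.card_congr (MulAction.orbitProdStabilizerEquivGroup (ConjAct G) g)

theorem orderOf_restrictScalars (K : Type*) {E L : Type*} [Field K] [Field E]
    [Field L] [Algebra K E] [Algebra K L] [Algebra E L] [IsScalarTower K E L] {σ : Gal(L/E)}
    (hgen : ∀ τ : Gal(L/E), τ ∈ Subgroup.zpowers σ) :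
    orderOf (σ.restrictScalars K) = Nat.card Gal(L/E) := by
  rw [← orderOf_eq_card_of_forall_mem_zpowers hgen]
  exact orderOf_injective (AlgEquiv.restrictScalarsHom K) (AlgEquiv.restrictScalars_injective K) σ

open scoped Classical in
theorem card_degree_ne_one_le (K : Type*) {E L : Type*} [Field K] [NumberField K] [Field E]
    [NumberField E] [Field L] [NumberField L] [Algebra K E] [Algebra E L] [IsGalois E L]
    (σ : Gal(L/E)) (S : Finset (FinitePrime E)) (x : ℝ) :
    (((primesUpTo S x).filter fun q => σ ∈ frobenius L q.1 ∧
      primeNorm q.1 ≠ primeNorm (q.1.under (𝓞 K))).card : ℝ) ≤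
    Module.finrank ℤ (𝓞 E) * (√x + 1) := by
  rw [← Finset.card_map (Function.Embedding.subtype _)]
  refine card_le_of_residueChar_sq_le fun q' hq' => ?_
  obtain ⟨q, hq, rfl⟩ := Finset.mem_map.mp hq'
  obtain ⟨hqx, -, hdeg⟩ := Finset.mem_filter.mp hq
  refine le_trans ?_ ((mem_primesUpTo _ _ _).mp hqx)
  exact_mod_cast residueChar_sq_le_of_ne K hdeg

section Tower

variable (K : Type*) {E L : Type*} [Field K] [NumberField K] [Field E] [NumberField E]
  [Field L] [NumberField L] [Algebra K E] [Algebra K L] [Algebra E L] [IsScalarTower K E L]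
  [IsGalois K L] [IsGalois E L]

open scoped Classical in
theorem isFrobenian_indicator {σ : Gal(L/E)} (hcomm : ∀ τ τ' : Gal(L/E), IsConj τ τ' → τ = τ')
    {S : Finset (FinitePrime E)} (hS : ∀ q ∉ S, Unramified L q) :
    IsFrobenian L S (fun q => if σ ∈ frobenius L q.1 then (1 : ℝ) else 0)
      (fun τ => if τ = σ then (1 : ℝ) else 0) where
  unramified := hS
  classFunction g h hgh := by rw [hcomm g h hgh]
  eq_apply q τ hτ := by
    have : σ ∈ frobenius L q.1 ↔ τ = σ :=
      ⟨fun h => hcomm _ _ (isConj_of_mem_frobenius (hS _ q.2) hτ h), fun h => h ▸ hτ⟩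
    simp only [this]

theorem finite_primeCount_set (C : ConjClasses Gal(L/K)) (x : ℝ) :
    {p : FinitePrime K | Unramified L p ∧ frobenius L p = C.carrier ∧
      (primeNorm p : ℝ) ≤ x}.Finite :=
  (finite_primeNorm_le K x).subset fun _ hp => hp.2.2

-- Counts the primes q along q ↦ q ∩ K: each fibre over Γ_C has |Z|/|H| elements, whence the form
-- without division. The choice of S makes every q outside it lie over a prime of K unramified in L.
open scoped Classical in
theorem card_degree_one_mul {σ : Gal(L/E)} (hgen : ∀ τ : Gal(L/E), τ ∈ Subgroup.zpowers σ)
    {S : Finset (FinitePrime E)} (hS : ∀ q, q ∈ S ↔ ¬ Unramified L (q.under (𝓞 K))) (x : ℝ) :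
    ((primesUpTo S x).filter fun q => σ ∈ frobenius L q.1 ∧
      primeNorm q.1 = primeNorm (q.1.under (𝓞 K))).card * Nat.card Gal(L/E) =
    primeCount (ConjClasses.mk (σ.restrictScalars K)) x *
      Nat.card (Subgroup.centralizer {σ.restrictScalars K}) := by
  set C := ConjClasses.mk (σ.restrictScalars K)
  set T := (primesUpTo S x).filter fun q => σ ∈ frobenius L q.1 ∧
      primeNorm q.1 = primeNorm (q.1.under (𝓞 K))
  set A := (finite_primeCount_set K C x).toFinset
  have hA (p : FinitePrime K) : p ∈ A ↔ Unramified L p ∧ σ.restrictScalars K ∈ frobenius L p ∧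
      (primeNorm p : ℝ) ≤ x := by
    rw [Set.Finite.mem_toFinset]
    refine and_congr_right fun hp => ?_
    rw [frobenius_eq_carrier_iff hp]
  have hmaps : Set.MapsTo (fun q : {q : FinitePrime E // q ∉ S} => q.1.under (𝓞 K)) T A := by
    intro q hq
    obtain ⟨hqx, ⟨P, hP, h⟩, hdeg⟩ := Finset.mem_filter.mp hq
    rw [mem_primesUpTo, hdeg] at hqx
    have hunr : Unramified L (q.1.under (𝓞 K)) := by simpa [hS] using q.2
    have := hP.1
    have := hP.2
    have := finite_quotient_of_mem_primesOver hP
    have hover : P.under (𝓞 E) = q.1.asIdeal := hP.2.over.symm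
    have hunder : (P.under (𝓞 E)).under (𝓞 K) = P.under (𝓞 K) := Ideal.under_under _
    refine (hA _).mpr ⟨hunr, ⟨P, ⟨hP.1, ⟨?_⟩⟩,
      (isArithFrobAt_restrictScalars_iff K σ P).mpr ⟨h, ?_⟩⟩, hqx⟩
    · rw [← hunder, hover]
      rfl
    · rw [primeNorm_eq_natCard, primeNorm_eq_natCard] at hdeg
      rw [← hunder, hover]
      exact hdeg
  rw [Finset.card_eq_sum_card_fiberwise hmaps, Finset.sum_mul, Finset.sum_eq_card_nsmul
    (b := Nat.card (Subgroup.centralizer {σ.restrictScalars K})), smul_eq_mul, primeCount,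
    Set.ncard_eq_toFinset_card _ (finite_primeCount_set K C x)]
  intro p hp
  obtain ⟨hunr, hσ, hpx⟩ := (hA p).mp hp
  rw [← ncard_primesOver_isArithFrobAt hunr hσ, orderOf_restrictScalars K hgen,
    ← ncard_fibre_eq K hgen p, ← Set.ncard_coe_finset,
    ← Set.ncard_image_of_injective _ Subtype.val_injective]
  congr 2
  ext q
  constructor
  · rintro ⟨q, hq, rfl⟩
    obtain ⟨hqT, rfl⟩ := Finset.mem_filter.mp hq
    have hqT' := (Finset.mem_filter.mp hqT).2
    exact ⟨rfl, hqT'.2, hqT'.1⟩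
  · rintro ⟨rfl, hdeg, h⟩
    refine ⟨⟨q, by simpa [hS] using hunr⟩, ?_, rfl⟩
    exact Finset.mem_filter.mpr ⟨Finset.mem_filter.mpr
      ⟨(mem_primesUpTo _ _ _).mpr (hdeg ▸ hpx), h, hdeg⟩, rfl⟩

/-- The density theorem for the class of `σ` over `K` follows from the one over a field `E` such
that `σ` generates `Gal(L/E)`. -/
theorem hasDensity_of_hasMean {σ : Gal(L/E)} (hgen : ∀ τ : Gal(L/E), τ ∈ Subgroup.zpowers σ)
    (hmean : ∀ (S : Finset (FinitePrime E)) (ψ : {q : FinitePrime E // q ∉ S} → ℝ)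
      (φ : Gal(L/E) → ℝ), IsFrobenian L S ψ φ →
        HasMean S ψ ((Nat.card Gal(L/E) : ℝ)⁻¹ * ∑ h : Gal(L/E), φ h)) :
    HasDensity (ConjClasses.mk (σ.restrictScalars K))
      (Nat.card (Subgroup.centralizer {σ.restrictScalars K}) : ℝ)⁻¹ := by
  classical
  -- This S may exceed the ramified primes of L/E: it also discards primes of E above primes of K
  -- that ramify in L.
  set S := (finite_preimage_under (E := E) K (finite_not_unramified K L)).toFinset
  have hS (q : FinitePrime E) : q ∈ S ↔ ¬ Unramified L (q.under (𝓞 K)) := by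
    simp [S]
  have hcomm (τ τ' : Gal(L/E)) (h : IsConj τ τ') : τ = τ' := by
    obtain ⟨g, rfl⟩ := isConj_iff.mp h
    obtain ⟨a, rfl⟩ := hgen g
    obtain ⟨b, rfl⟩ := hgen τ
    simp only [← zpow_add, ← zpow_neg]
    congr 1
    ring
  have hlim := hmean S _ _ (isFrobenian_indicator (σ := σ) hcomm
    fun q hq => Unramified.of_under K (by simpa [hS] using hq))
  simp only [HasMean, Finset.sum_ite_eq', Finset.mem_univ, if_true, mul_one, Finset.sum_boole]
    at hlim
  have hbad : Tendsto (fun x : ℝ => (((primesUpTo S x).filter fun q => σ ∈ frobenius L q.1 ∧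
      primeNorm q.1 ≠ primeNorm (q.1.under (𝓞 K))).card : ℝ) / Li x) atTop (𝓝 0) := by
    have hbound : Tendsto (fun x : ℝ => (Module.finrank ℤ (𝓞 E) : ℝ) * ((√x + 1) / Li x))
        atTop (𝓝 0) := by
      simpa using tendsto_sqrt_add_one_div_Li.const_mul (Module.finrank ℤ (𝓞 E) : ℝ)
    have hLi : ∀ᶠ x in atTop, 0 ≤ Li x := by
      filter_upwards [eventually_ge_atTop 2] with x hx
      exact le_trans (div_nonneg (by linarith) (Real.log_nonneg (by linarith))) (le_Li hx)
    refine squeeze_zero' ?_ ?_ hbound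
    · filter_upwards [hLi] with x hx
      positivity
    · filter_upwards [hLi] with x hx
      rw [← mul_div_assoc]
      gcongr
      exact card_degree_ne_one_le K σ S x
  set n : ℝ := (Nat.card Gal(L/E) : ℝ)
  set z : ℝ := (Nat.card (Subgroup.centralizer {σ.restrictScalars K}) : ℝ)
  have hn : n ≠ 0 := Nat.cast_ne_zero.mpr Nat.card_pos.ne'
  have hz : z ≠ 0 := Nat.cast_ne_zero.mpr Nat.card_pos.ne'
  -- Removing the negligible primes leaves those with equal norms; n/z inverts the fibre size.
  have hfin := (hlim.sub hbad).mul_const (n / z)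
  have hval : (n⁻¹ - 0) * (n / z) = z⁻¹ := by
    field_simp
    ring
  rw [hval] at hfin
  refine hfin.congr fun x => ?_
  have hone := congrArg (Nat.cast (R := ℝ)) (card_degree_one_mul K hgen hS x)
  rw [Nat.cast_mul, Nat.cast_mul] at hone
  have hsplit := Finset.card_filter_add_card_filter_not (s := (primesUpTo S x).filter
    fun q => σ ∈ frobenius L q.1) (p := fun q => primeNorm q.1 = primeNorm (q.1.under (𝓞 K)))
  rw [Finset.filter_filter, Finset.filter_filter] at hsplit
  rw [← hsplit, Nat.cast_add, ← sub_div, add_sub_cancel_right, ← mul_div_right_comm,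
    ← mul_div_assoc, hone, mul_div_cancel_right₀ _ hz]

end Tower

end PrimeCounting

/-! ### Reduction to the fixed field of a cyclic subgroup -/

theorem mainTheorem2
    (cyclicCase : ∀ (E M : Type u) [Field E] [NumberField E] [Field M] [NumberField M]
      [Algebra E M] [IsGalois E M] [IsCyclic Gal(M/E)]
      (S : Finset (PrimeCounting.FinitePrime E))
      (ψ : {p : PrimeCounting.FinitePrime E // p ∉ S} → ℝ) (φ : Gal(M/E) → ℝ),
      PrimeCounting.IsFrobenian M S ψ φ →
        PrimeCounting.HasMean S ψ ((Nat.card Gal(M/E) : ℝ)⁻¹ * ∑ h : Gal(M/E), φ h))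
    (K : Type v) (L : Type u) [Field K] [NumberField K] [Field L] [NumberField L]
    [Algebra K L] [IsGalois K L] (C : ConjClasses Gal(L/K)) :
    PrimeCounting.HasDensity C ((Nat.card C.carrier : ℝ) / (Nat.card Gal(L/K) : ℝ)) := by
  obtain ⟨σ, rfl⟩ := ConjClasses.mk_surjective C
  let H := Subgroup.zpowers σ
  -- As a subfield of L, E lies in the universe of L, so the cyclic hypothesis applies even though K
  -- may lie in another.
  let E := IntermediateField.fixedField H
  have : NumberField E := NumberField.of_module_finite K E
  have hfix : E.fixingSubgroup = H := IntermediateField.fixingSubgroup_fixedField H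
  let e : Gal(L/E) ≃* E.fixingSubgroup := (IntermediateField.fixingSubgroupEquiv E).symm
  let τ : Gal(L/E) := e.symm ⟨σ, hfix ▸ Subgroup.mem_zpowers σ⟩
  have hτ : τ.restrictScalars K = σ := rfl
  have hgen (g : Gal(L/E)) : g ∈ Subgroup.zpowers τ := by
    have hg : g.restrictScalars K ∈ H := hfix ▸ (e g).2
    obtain ⟨k, hk⟩ := hg
    refine ⟨k, AlgEquiv.restrictScalars_injective K ?_⟩
    exact (map_zpow (AlgEquiv.restrictScalarsHom K) τ k).trans hk
  have : IsCyclic Gal(L/E) := ⟨τ, hgen⟩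
  have h := PrimeCounting.hasDensity_of_hasMean K hgen (cyclicCase E L)
  rw [hτ] at h
  convert h using 1
  rw [← PrimeCounting.natCard_carrier_mul_natCard_centralizer σ, Nat.cast_mul, div_mul_cancel_left₀]
  exact Nat.cast_ne_zero.mpr (Nat.card_pos_iff.mpr
    ⟨⟨σ, ConjClasses.mem_carrier_mk⟩, inferInstance⟩).ne'
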